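/- Let $p$ be a prime, $K/\mathbb{Q}_p$ a finite extension with ring of integers $R$, maximal ideal $\mathfrak p$ and residue field $\mathbb F=R/\mathfrak p$. Let $G/R$ be a commutative group scheme, with the group laws on $G(R)$ and $G(\mathbb F)$ written multiplicatively. For $a\in G(R)$ let $\tau(a)$ be the order of the reduction $a \bmod \mathfrak p$ in $G(\mathbb F)$. For an abelian group $A$ let $A_{\mathrm{tors}}^{(p')}$ be the subgroup of elements of finite order prime to $p$, and put $G'(\mathbb F)=G(\mathbb F)_{\mathrm{tors}}^{(p')}$ and $$G'(R)=\{a\in G(R) : a \bmod \mathfrak p\in G'(\mathbb F)\}=\{a\in G(R):\tau(a)<\infty,\ p\nmid\tau(a)\}.$$ Give $G(R)$ the $\mathfrak p$-adic topology, i.e. the coarsest topology for which all the maps $G(R)\to G(R/\mathfrak p^n)$, with discrete targets, are continuous. Then: (a) There is a unique homomorphism $\chi: G'(R)\to G(R)_{\mathrm{tors}}^{(p')}$ satisfying $\chi(a)\equiv a \pmod{\mathfrak p}$ for all $a\in G'(R)$. If moreover no element of order $p$ of $G(R)$ reduces to the identity modulo $\mathfrak p$, then $\chi$ is the unique homomorphism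 $G'(R)\to G(R)_{\mathrm{tors}}$ with this property. (b) For every $a\in G'(R)$ one has $$\chi(a)=\lim_{\substack{k\to\infty\\ p^k\equiv 1 \ (\mathrm{mod}\ \tau(a))}} a^{p^k},$$ where the limit exists in $G(R)$ and is unique. (c) For every $a\in G'(R)$ the order of $\chi(a)$ is exactly $\tau(a)$. (d) The reduction map $G(R)_{\mathrm{tors}}^{(p')}\to G'(\mathbb F)$ is injective, and if $G$ is smooth over $R$, it is an isomorphism. If no element of order $p$ of $G(R)$ reduces to the identity modulo $\mathfrak p$, then $G(R)_{\mathrm{tors}}^{(p')}$ is the whole torsion subgroup of $G'(R)$. -/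

import Mathlib

open CategoryTheory AlgebraicGeometry
open scoped MonObj

universe u

noncomputable section

/-- The subgroup of elements of finite order prime to `p` of a commutative group
(`orderOf a = 0` if `a` has infinite order, so such an `a` is not in it). -/
def primeToPart (p : ℕ) [hp : Fact p.Prime] (A : Type*) [CommGroup A] : Subgroup A where
  carrier := {a | ¬ p ∣ orderOf a}
  one_mem' := by
    simpa using hp.out.one_lt.ne'
  mul_mem' := by
    intro a b ha hb h
    have h1 : orderOf (a * b) ∣ orderOf a * orderOf b :=
      (Commute.all a b).orderOf_mul_dvd_mul_orderOf
    exact (hp.out.dvd_mul.mp (h.trans h1)).elim ha hb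
  inv_mem' := by
    intro a ha
    simpa using ha

/-- A homomorphism of commutative groups maps prime-to-`p` parts to prime-to-`p` parts. -/
def primeToPartMap (p : ℕ) [Fact p.Prime] {A B : Type*} [CommGroup A] [CommGroup B]
    (f : A →* B) : primeToPart p A →* primeToPart p B :=
  (f.comp (primeToPart p A).subtype).codRestrict (primeToPart p B)
    fun a h => a.2 (h.trans (orderOf_map_dvd f a.1))

section Points

variable {R : Type u} [CommRing R]

/-- The set `G(A)` of `A`-valued points of an `R`-scheme `G`: the `R`-morphisms
`Spec A ⟶ G`. It carries Mathlib's (commutative) group structure when `G` is a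
(commutative) group scheme over `R`. -/
abbrev SchemePoints (G : Over (Spec (CommRingCat.of R))) (A : Type u) [CommRing A]
    [Algebra R A] : Type u :=
  Over.mk (Spec.map (CommRingCat.ofHom (algebraMap R A))) ⟶ G

/-- The `R`-morphism `Spec A' ⟶ Spec A` given by an `R`-algebra homomorphism `A → A'`. -/
def specOverMap {A A' : Type u} [CommRing A] [CommRing A'] [Algebra R A] [Algebra R A']
    (f : A →ₐ[R] A') :
    Over.mk (Spec.map (CommRingCat.ofHom (algebraMap R A'))) ⟶
      Over.mk (Spec.map (CommRingCat.ofHom (algebraMap R A))) :=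
  Over.homMk (Spec.map (CommRingCat.ofHom f.toRingHom)) (by
    simp only [Over.mk_left, Over.mk_hom, ← Spec.map_comp, ← CommRingCat.ofHom_comp]
    congr 2
    exact f.comp_algebraMap)

variable (G : Over (Spec (CommRingCat.of R))) [GrpObj G]

/-- The reduction homomorphism `G(R) → G(R / I)` modulo an ideal `I` of `R`. -/
def reduction (I : Ideal R) : SchemePoints G R →* SchemePoints G (R ⧸ I) where
  toFun a := specOverMap (Ideal.Quotient.mkₐ R I) ≫ a
  map_one' := MonObj.comp_one _
  map_mul' a b := MonObj.comp_mul _ a b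

/-- The `𝔭`-adic topology on `G(R)`: the coarsest one for which all the reductions
`G(R) → G(R / 𝔭 ^ n)` are continuous for the discrete topologies. Thus `a i → b` iff for
every `n`, eventually `a i ≡ b` modulo `𝔭 ^ n`. -/
abbrev adicTopology (𝔭 : Ideal R) : TopologicalSpace (SchemePoints G R) :=
  ⨅ n : ℕ, TopologicalSpace.induced (reduction G (𝔭 ^ n)) ⊥

variable [IsCommMonObj G]

/-- `G'(R)`: the group of those points of `G(R)` whose reduction modulo `𝔭` has (finite)
order prime to `p`. -/
def pointsPrimeToP (p : ℕ) [Fact p.Prime] (𝔭 : Ideal R) : Subgroup (SchemePoints G R) :=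
  (primeToPart p (SchemePoints G (R ⧸ 𝔭))).comap (reduction G 𝔭)

end Points

end

/-! Let `N n` be the kernel of `G(R) → G(R/𝔭^n)`. Three facts suffice: `N` is separated, it is
complete, and `x ^ p ^ n ∈ N n` whenever `x` reduces to 1 modulo `𝔭`. If the reduction of `a` has
order `t` prime to `p`, then `a ^ t` reduces to 1, so the powers `a ^ p ^ k` with `p ^ k ≡ 1` modulo
`t` are Cauchy. Their limit `b` satisfies `b ^ t = 1` and has the same reduction as `a`. By Bézout
the kernel of reduction has no nontrivial element of order prime to `p`; this gives uniqueness and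
multiplicativity of `χ`, and the order of `χ a`.

Since `G` is an arbitrary group scheme, points over a local ring are handled as ring homomorphisms
out of a stalk (`exists_comp_fromSpecStalk_eq`); separatedness and completeness are then inherited
from `R`. For the third fact, `J = 𝔭^(n+1)/𝔭^(n+2)` has square zero and is killed by `p`. Two points
over `S` congruent modulo such a `J` define a point over `S ⊕ J`, where adding linear maps on `J`
becomes the group law (`pointsMap_sqZeroMap_add`), so `p` kills `N (n+1) / N (n+2)`.

In the smooth case Hensel's lemma makes reduction surjective. Of `R` only this is used: it is local
and `𝔭`-adically complete, with `p ∈ 𝔭`. -/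

/-! ### Teichmüller representatives in a filtered abelian group. -/

/-- Data of a decreasing filtration `N n` of an abelian group, abstracting the congruence
filtration of `G(R)`: the group is separated and complete and the first step is pro-`p`. -/
structure IsProPFiltration (p : ℕ) {A : Type*} [CommGroup A] (N₁ : Subgroup A)
    (N : ℕ → Subgroup A) : Prop where
  protected antitone : Antitone N
  le : ∀ n, N (n + 1) ≤ N₁
  separated : ∀ x, (∀ n, x ∈ N n) → x = 1
  complete : ∀ u : ℕ → A, (∀ n, u (n + 1) / u n ∈ N n) → ∃ L, ∀ n, L / u n ∈ N n
  pow_pow_mem : ∀ n, ∀ x ∈ N₁, x ^ p ^ n ∈ N n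

theorem mem_primeToPart_of_pow_eq_one {p : ℕ} [Fact p.Prime] {A : Type*} [CommGroup A] {a : A}
    {n : ℕ} (hn : ¬ p ∣ n) (h : a ^ n = 1) : a ∈ primeToPart p A :=
  fun hp => hn (hp.trans (orderOf_dvd_of_pow_eq_one h))

theorem orderOf_pos_of_not_dvd {p : ℕ} {A : Type*} [Monoid A] {a : A}
    (h : ¬ p ∣ orderOf a) : 0 < orderOf a :=
  Nat.pos_of_ne_zero fun h0 => h (h0 ▸ dvd_zero p)

/-- By Euler, every multiple of `φ(t)` is such a `k`. Nontriviality of the filter is what makes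
limits along it unique. -/
theorem neBot_atTop_inf_principal_pow_modEq_one {p t : ℕ} (hp : p.Coprime t) (ht : 0 < t) :
    (Filter.atTop ⊓ Filter.principal {k : ℕ | p ^ k ≡ 1 [MOD t]}).NeBot := by
  rw [← Filter.frequently_mem_iff_neBot, Filter.frequently_atTop]
  refine fun n => ⟨t.totient * n, Nat.le_mul_of_pos_left n (Nat.totient_pos.2 ht), ?_⟩
  have := (Nat.ModEq.pow_totient hp).pow n
  rwa [one_pow, ← pow_mul] at this

/-- If no element of order `p` lies in the kernel of `r`, then a torsion element whose image has
order prime to `p` has order prime to `p`. -/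
theorem mem_primeToPart_of_isOfFinOrder {p : ℕ} [hp : Fact p.Prime] {A B : Type*} [CommGroup A]
    [CommGroup B] {r : A →* B} (h : ∀ x, r x = 1 → x ^ p = 1 → x = 1) {a : A}
    (ha : r a ∈ primeToPart p B) (hfin : IsOfFinOrder a) : a ∈ primeToPart p A := by
  obtain ⟨j, m, hm, he⟩ :=
    Nat.exists_eq_pow_mul_and_not_dvd hfin.orderOf_pos.ne' p hp.out.ne_one
  have key : ∀ i, ∀ x, r x = 1 → x ^ p ^ i = 1 → x = 1 := by
    intro i
    induction i with
    | zero => intro x _ hx; simpa using hx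
    | succ i ih =>
      intro x hx hxi
      refine h x hx (ih _ (by rw [map_pow, hx, one_pow]) ?_)
      rw [← pow_mul, ← pow_succ', hxi]
  -- With `orderOf a = p ^ j * m`, the element `a ^ (orderOf (r a) * m)` lies in the kernel and is
  -- killed by `p ^ j`, hence is 1.
  refine mem_primeToPart_of_pow_eq_one (n := orderOf (r a) * m)
    (fun hd => (hp.out.dvd_mul.1 hd).elim ha hm) (key j _ ?_ ?_)
  · rw [map_pow, pow_mul, pow_orderOf_eq_one, one_pow]
  · rw [← pow_mul, mul_assoc, mul_comm m, ← he, mul_comm, pow_mul, pow_orderOf_eq_one, one_pow]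

namespace IsProPFiltration

variable {p : ℕ} [hp : Fact p.Prime] {A B : Type*} [CommGroup A] [CommGroup B] {r : A →* B}
  {N : ℕ → Subgroup A} (hN : IsProPFiltration p r.ker N)
include hN

/-- Bézout for `p ^ n` and `m` writes `x` through `x ^ p ^ n ∈ N n` and `x ^ m = 1`, so `x` lies in
every `N n`. -/
theorem eq_one_of_pow_eq_one {x : A} (hx : r x = 1) {m : ℕ} (hm : ¬ p ∣ m) (h : x ^ m = 1) :
    x = 1 := by
  refine hN.separated x fun n => ?_
  have h1 := hN.pow_pow_mem n x hx
  have hc : (p ^ n).Coprime m := ((hp.out.coprime_iff_not_dvd).2 hm).pow_left n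
  have h2 : x ^ m ∈ N n := h ▸ one_mem _
  rw [← zpow_natCast] at h1 h2
  have key : x = (x ^ ((p ^ n : ℕ) : ℤ)) ^ Nat.gcdA (p ^ n) m *
      (x ^ (m : ℤ)) ^ Nat.gcdB (p ^ n) m := by
    rw [← zpow_mul, ← zpow_mul, ← zpow_add, ← Nat.gcd_eq_gcd_ab, hc.gcd_eq_one]
    simp
  rw [key]
  exact mul_mem (zpow_mem h1 _) (zpow_mem h2 _)

theorem injective : Function.Injective (primeToPartMap p r) := by
  rw [injective_iff_map_eq_one]
  intro a ha
  ext
  exact hN.eq_one_of_pow_eq_one (congrArg Subtype.val ha) a.2 (pow_orderOf_eq_one _)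

theorem eq_of_map_eq {a b : A} (ha : a ∈ primeToPart p A) (hb : b ∈ primeToPart p A)
    (h : r a = r b) : a = b :=
  congrArg Subtype.val (hN.injective (a₁ := ⟨a, ha⟩) (a₂ := ⟨b, hb⟩) (Subtype.ext h))

omit hp in
-- Writing `j = t * c + 1`, the quotient is `((a ^ t) ^ p ^ n) ^ c` with `a ^ t` in the kernel of
-- `r`.
theorem pow_div_self_mem {a : A} {t : ℕ} (ht : r a ^ t = 1) {n j : ℕ} (hj : j ≡ 1 [MOD t])
    (hj0 : 0 < j) : (a ^ p ^ n) ^ j / a ^ p ^ n ∈ N n := by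
  obtain ⟨c, hc⟩ := (Nat.modEq_iff_dvd' hj0).1 hj.symm
  have h1 := pow_mem (hN.pow_pow_mem n (a ^ t) (by rw [MonoidHom.mem_ker, map_pow, ht])) c
  convert h1 using 1
  rw [div_eq_iff_eq_mul, ← pow_mul, ← pow_mul, ← pow_mul, ← pow_add]
  congr 1
  have : j = t * c + 1 := by omega
  rw [this]
  ring

/-- The Cauchy property: for `l = k + d`, cancelling `p ^ k` gives `p ^ d ≡ 1` modulo `t`, and `j =
p ^ d` is admissible in `pow_div_self_mem`. -/
theorem pow_div_pow_mem {a : A} {t : ℕ} (hpt : p.Coprime t) (ht : r a ^ t = 1) {n k l : ℕ}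
    (hk : n ≤ k) (hkl : k ≤ l) (h : p ^ k ≡ p ^ l [MOD t]) : a ^ p ^ l / a ^ p ^ k ∈ N n := by
  obtain ⟨d, rfl⟩ := Nat.exists_eq_add_of_le hkl
  have h1 : p ^ d ≡ 1 [MOD t] := by
    refine Nat.ModEq.cancel_left_of_coprime (c := p ^ k) ?_ ?_
    · rw [Nat.gcd_comm]; exact hpt.pow_left k
    · rw [mul_one, ← pow_add]; exact h.symm
  have := hN.pow_div_self_mem ht (n := k) h1 (pow_pos hp.out.pos d)
  rw [← pow_mul, ← pow_add] at this
  exact hN.antitone hk this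

/-- Existence of the Teichmüller representative. -/
theorem exists_teichmuller {a : A} (ha : r a ∈ primeToPart p B) :
    ∃ b ∈ primeToPart p A, r b = r a ∧
      ∀ n, ∀ k ≥ n, p ^ k ≡ 1 [MOD orderOf (r a)] → b / a ^ p ^ k ∈ N n := by
  set t := orderOf (r a) with ht
  have hta : r a ^ t = 1 := pow_orderOf_eq_one _
  have htpos : 0 < t := orderOf_pos_of_not_dvd ha
  have hpt : p.Coprime t := (hp.out.coprime_iff_not_dvd).2 ha
  have hφ : 0 < t.totient := Nat.totient_pos.2 htpos
  have hmod : ∀ n, p ^ (t.totient * n) ≡ 1 [MOD t] := fun n => by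
    simpa [← pow_mul] using (Nat.ModEq.pow_totient hpt).pow n
  obtain ⟨b, hb⟩ := hN.complete (fun n => a ^ p ^ (t.totient * n)) fun n =>
    hN.pow_div_pow_mem hpt hta (Nat.le_mul_of_pos_left n hφ)
      (Nat.mul_le_mul_left _ n.le_succ) ((hmod _).trans (hmod _).symm)
  -- From the subsequence `φ(t) * n` to every admissible `k`: insert `a ^ p ^ (φ(t) * k)` between
  -- `b` and `a ^ p ^ k`.
  have hlim : ∀ n, ∀ k ≥ n, p ^ k ≡ 1 [MOD t] → b / a ^ p ^ k ∈ N n := by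
    intro n k hk h
    have hle : k ≤ t.totient * k := Nat.le_mul_of_pos_left k hφ
    have h1 := hN.pow_div_pow_mem hpt hta hk hle (h.trans (hmod _).symm)
    have h2 := hN.antitone hk (hb k)
    simpa using mul_mem h2 h1
  -- Level 1 is needed here: `N 0` need not lie in the kernel of `r`.
  have hrb : r b = r a := by
    have h1 := hN.le 0 (hlim 1 _ (Nat.le_mul_of_pos_left 1 hφ) (hmod 1))
    rw [MonoidHom.mem_ker, map_div, div_eq_one, map_pow] at h1
    rw [h1, pow_eq_pow_iff_modEq.2 (hmod 1), pow_one]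
  -- `b ^ t = 1`, because `b ^ t` is `(b / a ^ p ^ k) ^ t` times `(a ^ t) ^ p ^ k`, and both tend to
  -- 1.
  refine ⟨b, mem_primeToPart_of_pow_eq_one ha (hN.separated _ fun n => ?_), hrb, hlim⟩
  have h1 := pow_mem (hb n) t
  have h2 : (a ^ t) ^ p ^ (t.totient * n) ∈ N n :=
    hN.antitone (Nat.le_mul_of_pos_left n hφ)
      (hN.pow_pow_mem _ _ (by rw [MonoidHom.mem_ker, map_pow, hta]))
  have := mul_mem h1 h2
  rwa [div_pow, ← pow_mul, ← pow_mul, mul_comm t, div_mul_cancel] at this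

/-- The Teichmüller character. -/
theorem exists_character {H : Subgroup A} (hH : ∀ a ∈ H, r a ∈ primeToPart p B) :
    ∃ χ : H →* primeToPart p A, (∀ a, r (χ a) = r a) ∧
      ∀ (a : H) (n : ℕ), ∀ k ≥ n, p ^ k ≡ 1 [MOD orderOf (r a)] →
        (χ a : A) / (a : A) ^ p ^ k ∈ N n := by
  choose f hf hr hlim using fun a : H => hN.exists_teichmuller (hH a a.2)
  refine ⟨{ toFun a := ⟨f a, hf a⟩, map_one' := ?_, map_mul' := fun a b => ?_ }, hr, hlim⟩
  · ext
    exact hN.eq_of_map_eq (hf _) (one_mem _) (by rw [hr]; simp)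
  · ext
    exact hN.eq_of_map_eq (hf _) (mul_mem (hf a) (hf b)) (by simp [hr])

theorem orderOf_map {a : A} (ha : a ∈ primeToPart p A) : orderOf a = orderOf (r a) := by
  have := orderOf_injective (primeToPartMap p r) hN.injective ⟨a, ha⟩
  rw [← Subgroup.orderOf_coe, ← Subgroup.orderOf_coe] at this
  exact this.symm

theorem surjective (hr : Function.Surjective r) : Function.Surjective (primeToPartMap p r) := by
  rintro ⟨b, hb⟩
  obtain ⟨a, rfl⟩ := hr b
  obtain ⟨c, hc, hca, -⟩ := hN.exists_teichmuller hb
  exact ⟨⟨c, hc⟩, Subtype.ext hca⟩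

end IsProPFiltration

/-! ### Adic completeness and the ring of integers of `K`. -/

section

open Polynomial IsLocalRing

theorem IsPrecomplete.of_pow_le {R : Type*} [CommRing R] {I J : Ideal R} [IsPrecomplete I R]
    (hIJ : I ≤ J) {e : ℕ} (hJI : J ^ e ≤ I) : IsPrecomplete J R := by
  refine ⟨fun f hf => ?_⟩
  simp only [SModEq.sub_mem, smul_eq_mul, Ideal.mul_top] at hf ⊢
  have hpow : ∀ n, J ^ (e * n) ≤ I ^ n := fun n => by
    rw [pow_mul]; exact Ideal.pow_right_mono hJI n
  -- Indices `e * n` already make the subsequence `I`-Cauchy; the factor `e + 1` also ensures that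
  -- the index is at least `n` when `e = 0`.
  obtain ⟨L, hL⟩ := IsPrecomplete.prec (I := I) (M := R) inferInstance
    (f := fun n => f ((e + 1) * n)) (fun {m n} hmn => by
      simp only [SModEq.sub_mem, smul_eq_mul, Ideal.mul_top]
      refine hpow m (Ideal.pow_le_pow_right ?_ (hf (Nat.mul_le_mul_left (e + 1) hmn)))
      exact Nat.mul_le_mul_right m e.le_succ)
  simp only [SModEq.sub_mem, smul_eq_mul, Ideal.mul_top] at hL
  refine ⟨L, fun n => ?_⟩
  have h1 := hf (Nat.le_mul_of_pos_left n e.succ_pos)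
  have h2 := Ideal.pow_right_mono hIJ n (hL n)
  simpa using add_mem h1 h2

/-- A finite module over an `I`-adically precomplete ring is `I`-adically precomplete. -/
theorem IsPrecomplete.of_moduleFinite {A M : Type*} [CommRing A] [AddCommGroup M] [Module A M]
    [Module.Finite A M] (I : Ideal A) [IsPrecomplete I A] : IsPrecomplete I M := by
  rw [← AdicCompletion.of_surjective_iff]
  intro y
  obtain ⟨t, rfl⟩ := AdicCompletion.ofTensorProduct_surjective_of_finite I M y
  induction t with
  | zero => exact ⟨0, by simp⟩
  | tmul r x =>
    obtain ⟨a, rfl⟩ := AdicCompletion.of_surjective I A r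
    refine ⟨a • x, ?_⟩
    rw [AdicCompletion.ofTensorProduct_tmul]
    ext n
    rfl
  | add s t hs ht =>
    obtain ⟨a, ha⟩ := hs
    obtain ⟨b, hb⟩ := ht
    exact ⟨a + b, by rw [map_add, map_add, ha, hb]⟩

section LocalField

variable (p : ℕ) [Fact p.Prime] (K : Type u) [Field K] [Algebra ℚ_[p] K]
  [FiniteDimensional ℚ_[p] K] [Algebra ℤ_[p] K] [IsScalarTower ℤ_[p] ℚ_[p] K]

theorem finite_integralClosure_padicInt : Module.Finite ℤ_[p] (integralClosure ℤ_[p] K) :=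
  IsIntegralClosure.finite ℤ_[p] ℚ_[p] K _

theorem isNoetherianRing_integralClosure_padicInt :
    IsNoetherianRing (integralClosure ℤ_[p] K) :=
  IsIntegralClosure.isNoetherianRing ℤ_[p] ℚ_[p] K _

variable {p K} in
-- Both sides say that the minimal polynomial over `ℚ_[p]` has coefficients in `ℤ_[p]`, which is
-- integrally closed.
theorem isIntegral_padicInt_iff_spectralNorm_le_one (x : K) :
    IsIntegral ℤ_[p] x ↔ spectralNorm ℚ_[p] K x ≤ 1 := by
  have hx : IsIntegral ℚ_[p] x := Algebra.IsIntegral.isIntegral x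
  rw [spectralNorm, spectralValue_le_one_iff (minpoly.monic hx)]
  constructor
  · intro h n
    rw [minpoly.isIntegrallyClosed_eq_field_fractions' ℚ_[p] h, coeff_map]
    exact PadicInt.norm_le_one _
  · intro h
    have hl : minpoly ℚ_[p] x ∈ Polynomial.lifts (algebraMap ℤ_[p] ℚ_[p]) := by
      rw [Polynomial.lifts_iff_coeff_lifts]
      exact fun n => ⟨⟨_, h n⟩, rfl⟩
    obtain ⟨q, hq, -, hm⟩ := Polynomial.lifts_and_degree_eq_and_monic hl (minpoly.monic hx)
    refine ⟨q, hm, ?_⟩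
    rw [IsScalarTower.algebraMap_eq ℤ_[p] ℚ_[p] K, ← eval₂_map, hq]
    exact minpoly.aeval _ _

/-- The spectral norm is multiplicative, so the nonunits are the elements of norm `< 1`; the
ultrametric inequality closes them under addition. -/
theorem isLocalRing_integralClosure_padicInt : IsLocalRing (integralClosure ℤ_[p] K) := by
  have hunit : ∀ a : integralClosure ℤ_[p] K, IsUnit a ↔ ¬ spectralNorm ℚ_[p] K a < 1 := by
    intro a
    have hle := (isIntegral_padicInt_iff_spectralNorm_le_one (p := p) (a : K)).1 a.2
    have hmul : ∀ x y : K, spectralNorm ℚ_[p] K (x * y) =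
      spectralNorm ℚ_[p] K x * spectralNorm ℚ_[p] K y := spectralAlgNorm_mul
    constructor
    · rintro ⟨u, rfl⟩ hlt
      have h1 := hmul (u : integralClosure ℤ_[p] K) (↑u⁻¹ : integralClosure ℤ_[p] K)
      have h2 := (isIntegral_padicInt_iff_spectralNorm_le_one (p := p) _).1
        (↑u⁻¹ : integralClosure ℤ_[p] K).2
      rw [← MulMemClass.coe_mul, Units.mul_inv, OneMemClass.coe_one, spectralNorm_one] at h1
      have h3 := spectralNorm_nonneg (K := ℚ_[p]) ((↑u : integralClosure ℤ_[p] K) : K)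
      have h4 := mul_le_of_le_one_right h3 h2
      linarith
    · intro h
      have h1 : spectralNorm ℚ_[p] K a = 1 := le_antisymm hle (not_lt.1 h)
      have h0 : (a : K) ≠ 0 := fun h0 => by simp [h0, spectralNorm_zero] at h1
      have h2 := hmul (a : K) (a : K)⁻¹
      rw [mul_inv_cancel₀ h0, spectralNorm_one, h1, one_mul] at h2
      refine IsUnit.of_mul_eq_one
        ⟨(a : K)⁻¹, (isIntegral_padicInt_iff_spectralNorm_le_one (p := p) _).2 h2.ge⟩ ?_
      ext
      simpa using mul_inv_cancel₀ h0
  refine IsLocalRing.of_nonunits_add fun a b ha hb => ?_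
  simp only [mem_nonunits_iff, hunit, not_not] at ha hb ⊢
  exact (isNonarchimedean_spectralNorm (K := ℚ_[p]) (a : K) b).trans_lt (max_lt ha hb)

variable (𝔭 : Ideal (integralClosure ℤ_[p] K)) [𝔭.IsMaximal]

omit [Algebra ℚ_[p] K] [FiniteDimensional ℚ_[p] K] [IsScalarTower ℤ_[p] ℚ_[p] K] in
theorem natCast_mem_maximal_integralClosure_padicInt :
    (p : integralClosure ℤ_[p] K) ∈ 𝔭 := by
  have h : (𝔭.comap (algebraMap ℤ_[p] (integralClosure ℤ_[p] K))).IsMaximal :=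
    Ideal.isMaximal_comap_of_isIntegral_of_isMaximal 𝔭
  rw [IsLocalRing.isMaximal_iff, PadicInt.maximalIdeal_eq_span_p] at h
  have : (p : ℤ_[p]) ∈ 𝔭.comap (algebraMap ℤ_[p] (integralClosure ℤ_[p] K)) := by
    rw [h]; exact Ideal.mem_span_singleton_self _
  simpa using this

/-- Finiteness over `ℤ_[p]` gives `p`-adic precompleteness. Every prime containing `p` lies over the
maximal ideal of `ℤ_[p]`, so it is maximal and equals `𝔭`; hence a power of `𝔭` lies in `(p)` and
the two topologies agree. -/
theorem isAdicComplete_integralClosure_padicInt :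
    IsAdicComplete 𝔭 (integralClosure ℤ_[p] K) := by
  have := finite_integralClosure_padicInt p K
  have := isNoetherianRing_integralClosure_padicInt p K
  have := isLocalRing_integralClosure_padicInt p K
  let R := integralClosure ℤ_[p] K
  let I : Ideal R := (maximalIdeal ℤ_[p]).map (algebraMap ℤ_[p] R)
  have hI : I = Ideal.span {(p : R)} := by
    simp [I, PadicInt.maximalIdeal_eq_span_p, Ideal.map_span]
  have hI𝔭 : I ≤ 𝔭 := by
    rw [hI, Ideal.span_singleton_le_iff_mem]
    exact natCast_mem_maximal_integralClosure_padicInt p K 𝔭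
  have hpre : IsPrecomplete I R :=
    (IsPrecomplete.map_algebraMap_iff ..).2 (IsPrecomplete.of_moduleFinite _)
  have hrad : 𝔭 ≤ I.radical := by
    rw [Ideal.radical_eq_sInf]
    refine le_sInf fun q hq => ?_
    have hqp := hq.2
    have hc : (q.comap (algebraMap ℤ_[p] R)) = maximalIdeal ℤ_[p] :=
      ((maximalIdeal.isMaximal _).eq_of_le (hqp.comap _).ne_top
        (Ideal.map_le_iff_le_comap.1 hq.1)).symm
    have : q.IsMaximal := Ideal.isMaximal_of_isIntegral_of_isMaximal_comap q
      (hc ▸ maximalIdeal.isMaximal _)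
    rw [IsLocalRing.eq_maximalIdeal this, IsLocalRing.eq_maximalIdeal ‹𝔭.IsMaximal›]
  obtain ⟨e, he⟩ := Ideal.exists_pow_le_of_le_radical_of_fg hrad (IsNoetherian.noetherian 𝔭)
  have := IsPrecomplete.of_pow_le hI𝔭 he
  have := IsHausdorff.of_isDomain 𝔭 Ideal.IsPrime.ne_top'
  exact {}

end LocalField

end

/-! ### Points over local rings as homomorphisms out of stalks. -/

section

open IsLocalRing

/-- A morphism from the spectrum of a local ring factors through the spectrum of the stalk at the
image of the closed point. -/
theorem exists_comp_fromSpecStalk_eq {T : Type u} [CommRing T] [IsLocalRing T] {X : Scheme.{u}}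
    (x : Spec (CommRingCat.of T) ⟶ X) (t : X) (ht : x (closedPoint T) = t) :
    ∃ φ : X.presheaf.stalk t →+* T,
      Spec.map (CommRingCat.ofHom φ) ≫ X.fromSpecStalk t = x := by
  subst ht
  exact ⟨(Scheme.stalkClosedPointTo x).hom, Scheme.Spec_stalkClosedPointTo_fromSpecStalk x⟩

/-- The map from the spectrum of a stalk to `X` is a monomorphism; no separatedness of `X` is
needed. -/
theorem comp_fromSpecStalk_injective {T : Type u} [CommRing T] {X : Scheme.{u}} {t : X}
    {φ ψ : X.presheaf.stalk t →+* T}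
    (h : Spec.map (CommRingCat.ofHom φ) ≫ X.fromSpecStalk t =
      Spec.map (CommRingCat.ofHom ψ) ≫ X.fromSpecStalk t) : φ = ψ := by
  have h1 := (cancel_mono _).1 h
  have h2 := Spec.map_injective h1
  exact congrArg CommRingCat.Hom.hom h2

theorem specMap_comp_apply_closedPoint {T S : Type u} [CommRing T] [IsLocalRing T]
    [CommRing S] [IsLocalRing S] {X : Scheme.{u}} (f : T →+* S) [IsLocalHom f]
    (x : Spec (CommRingCat.of T) ⟶ X) :
    (Spec.map (CommRingCat.ofHom f) ≫ x) (closedPoint S) = x (closedPoint T) := by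
  exact (Scheme.Hom.comp_apply _ _ _).trans (congrArg _ (IsLocalRing.comap_closedPoint f))

/-- A local homomorphism preserves closed points, so `x` and `y` send the closed point to the same
`t` and share a stalk. -/
theorem exists_comp_fromSpecStalk_eq_pair {T S : Type u} [CommRing T] [IsLocalRing T]
    [CommRing S] [IsLocalRing S] {X : Scheme.{u}} (f : T →+* S) [IsLocalHom f]
    {x y : Spec (CommRingCat.of T) ⟶ X}
    (h : Spec.map (CommRingCat.ofHom f) ≫ x = Spec.map (CommRingCat.ofHom f) ≫ y) :
    ∃ (t : X) (φ ψ : X.presheaf.stalk t →+* T),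
      Spec.map (CommRingCat.ofHom φ) ≫ X.fromSpecStalk t = x ∧
      Spec.map (CommRingCat.ofHom ψ) ≫ X.fromSpecStalk t = y := by
  have h0 : x (closedPoint T) = y (closedPoint T) := by
    rw [← specMap_comp_apply_closedPoint f, h, specMap_comp_apply_closedPoint]
  obtain ⟨φ, hφ⟩ := exists_comp_fromSpecStalk_eq x _ h0
  obtain ⟨ψ, hψ⟩ := exists_comp_fromSpecStalk_eq y _ rfl
  exact ⟨_, φ, ψ, hφ, hψ⟩

theorem comp_eq_of_specMap_comp_eq {T S : Type u} [CommRing T] [CommRing S] {X : Scheme.{u}}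
    {t : X} (f : T →+* S) {φ ψ : X.presheaf.stalk t →+* T}
    (h : Spec.map (CommRingCat.ofHom f) ≫ Spec.map (CommRingCat.ofHom φ) ≫ X.fromSpecStalk t =
      Spec.map (CommRingCat.ofHom f) ≫ Spec.map (CommRingCat.ofHom ψ) ≫ X.fromSpecStalk t) :
    f.comp φ = f.comp ψ := by
  rw [← Category.assoc, ← Category.assoc, ← Spec.map_comp, ← Spec.map_comp,
    ← CommRingCat.ofHom_comp, ← CommRingCat.ofHom_comp] at h
  exact comp_fromSpecStalk_injective h

/-- Morphisms from the spectrum of a local ring `T` are determined by their restrictions along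
a jointly injective family of ring homomorphisms out of `T`, one of which is local. -/
theorem spec_hom_ext {T : Type u} [CommRing T] [IsLocalRing T] {X : Scheme.{u}} {κ : Type*}
    {S : κ → Type u} [∀ i, CommRing (S i)] (f : ∀ i, T →+* S i)
    (hf : ∀ a b, (∀ i, f i a = f i b) → a = b) (i₀ : κ) [IsLocalRing (S i₀)] [IsLocalHom (f i₀)]
    {x y : Spec (CommRingCat.of T) ⟶ X}
    (h : ∀ i, Spec.map (CommRingCat.ofHom (f i)) ≫ x = Spec.map (CommRingCat.ofHom (f i)) ≫ y) :
    x = y := by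
  obtain ⟨t, φ, ψ, rfl, rfl⟩ := exists_comp_fromSpecStalk_eq_pair (f i₀) (h i₀)
  congr 3
  ext a
  exact hf _ _ fun i => congr($(comp_eq_of_specMap_comp_eq _ (h i)) a)

noncomputable section

section Points

variable {R : Type u} [CommRing R] {A A' A'' : Type u} [CommRing A] [CommRing A'] [CommRing A'']
  [Algebra R A] [Algebra R A'] [Algebra R A'']

theorem specOverMap_comp (g : A' →ₐ[R] A'') (f : A →ₐ[R] A') :
    specOverMap (g.comp f) = specOverMap g ≫ specOverMap f := by
  ext1
  simp only [specOverMap, Over.homMk_left, Over.comp_left, ← Spec.map_comp,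
    ← CommRingCat.ofHom_comp]
  rfl

variable (G : Over (Spec (CommRingCat.of R))) [GrpObj G]

/-- The homomorphism `G(A) → G(A')` induced by a homomorphism of `R`-algebras `A → A'`. -/
def pointsMap (f : A →ₐ[R] A') : SchemePoints G A →* SchemePoints G A' where
  toFun a := specOverMap f ≫ a
  map_one' := MonObj.comp_one _
  map_mul' a b := MonObj.comp_mul _ a b

theorem pointsMap_pointsMap (g : A' →ₐ[R] A'') (f : A →ₐ[R] A') (x : SchemePoints G A) :
    pointsMap G g (pointsMap G f x) = pointsMap G (g.comp f) x := by
  change specOverMap g ≫ specOverMap f ≫ x = specOverMap (g.comp f) ≫ x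
  rw [specOverMap_comp, Category.assoc]

theorem pointsMap_id (x : SchemePoints G A) : pointsMap G (AlgHom.id R A) x = x := by
  change specOverMap _ ≫ x = x
  convert Category.id_comp x
  ext1
  simp only [specOverMap, Over.homMk_left]
  exact Spec.map_id _

theorem pointsMap_left (f : A →ₐ[R] A') (x : SchemePoints G A) :
    (pointsMap G f x).left = Spec.map (CommRingCat.ofHom f.toRingHom) ≫ x.left := rfl

/-- Points with values in a local ring are determined by their images under a jointly injective
family of homomorphisms, one of which is local. -/
theorem points_ext [IsLocalRing A] {κ : Type*} {S : κ → Type u} [∀ i, CommRing (S i)]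
    [∀ i, Algebra R (S i)] (f : ∀ i, A →ₐ[R] S i) (hf : ∀ a b, (∀ i, f i a = f i b) → a = b)
    (i₀ : κ) [IsLocalRing (S i₀)] [IsLocalHom (f i₀).toRingHom] {x y : SchemePoints G A}
    (h : ∀ i, pointsMap G (f i) x = pointsMap G (f i) y) : x = y := by
  ext1
  exact spec_hom_ext (fun i => (f i).toRingHom) hf i₀ fun i => congrArg (·.left) (h i)

end Points

/-! ### Square-zero extensions and the group law. -/

section SquareZero

open TrivSqZeroExt

variable {S M N : Type u} [CommRing S] [AddCommGroup M] [Module S M] [Module Sᵐᵒᵖ M]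
  [IsCentralScalar S M] [AddCommGroup N] [Module S N] [Module Sᵐᵒᵖ N] [IsCentralScalar S N]

instance isLocalHom_fst : IsLocalHom (fstHom S S M).toRingHom :=
  ⟨fun _ h => isUnit_iff_isUnit_fst.2 h⟩

instance isLocalRing_trivSqZeroExt [IsLocalRing S] : IsLocalRing (TrivSqZeroExt S M) :=
  RingHom.domain_isLocalRing (fstHom S S M).toRingHom

instance isLocalHom_trivSqZeroExt_map (f : M →ₗ[S] N) :
    IsLocalHom (TrivSqZeroExt.map f).toRingHom :=
  ⟨fun a h => isUnit_iff_isUnit_fst.2 <| by simpa using isUnit_iff_isUnit_fst.1 h⟩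

variable {R : Type u} [CommRing R] [Algebra R S] [Module R M] [IsScalarTower R S M]
  [IsScalarTower R Sᵐᵒᵖ M] [Module R N] [IsScalarTower R S N] [IsScalarTower R Sᵐᵒᵖ N]

variable (R) in
/-- The `R`-algebra homomorphism of square-zero extensions induced by an `S`-linear map. -/
def sqZeroMap (f : M →ₗ[S] N) : TrivSqZeroExt S M →ₐ[R] TrivSqZeroExt S N :=
  (TrivSqZeroExt.map f).restrictScalars R

theorem sqZeroMap_apply (f : M →ₗ[S] N) (a : TrivSqZeroExt S M) :
    sqZeroMap R f a = inl a.fst + inr (f a.snd) := by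
  ext <;> simp [sqZeroMap]

variable (G : Over (Spec (CommRingCat.of R))) [GrpObj G]

theorem pointsMap_sqZeroMap_comp {P : Type u} [AddCommGroup P] [Module S P] [Module Sᵐᵒᵖ P]
    [IsCentralScalar S P] [Module R P] [IsScalarTower R S P] [IsScalarTower R Sᵐᵒᵖ P]
    (g : N →ₗ[S] P) (f : M →ₗ[S] N) (z : SchemePoints G (TrivSqZeroExt S M)) :
    pointsMap G (sqZeroMap R g) (pointsMap G (sqZeroMap R f) z) =
      pointsMap G (sqZeroMap R (g ∘ₗ f)) z := by
  have : (sqZeroMap R g).comp (sqZeroMap R f) = sqZeroMap R (g ∘ₗ f) := by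
    ext <;> simp [sqZeroMap]
  rw [pointsMap_pointsMap, this]

theorem pointsMap_sqZeroMap_zero {z : SchemePoints G (TrivSqZeroExt S M)}
    (hz : pointsMap G (fstHom R S M) z = 1) : pointsMap G (sqZeroMap R (0 : M →ₗ[S] N)) z = 1 := by
  have : sqZeroMap R (0 : M →ₗ[S] N) = (inlAlgHom R S N).comp (fstHom R S M) := by
    ext <;> simp [sqZeroMap]
  rw [this, ← pointsMap_pointsMap, hz, map_one]

/-- On points over `S ⊕ M` reducing to the identity over `S`, the addition of linear maps out of
`M` corresponds to the group law. -/
theorem pointsMap_sqZeroMap_add [IsLocalRing S] (u v : M →ₗ[S] N)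
    {z : SchemePoints G (TrivSqZeroExt S M)} (hz : pointsMap G (fstHom R S M) z = 1) :
    pointsMap G (sqZeroMap R (u + v)) z =
      pointsMap G (sqZeroMap R u) z * pointsMap G (sqZeroMap R v) z := by
  -- The two projections `S ⊕ (N × N) → S ⊕ N` are jointly injective on points. After each of them
  -- one factor on the right becomes 1, since it comes from the zero map. The sum map `N × N → N`
  -- then gives the claim.
  have key : pointsMap G (sqZeroMap R (LinearMap.prod u v)) z =
      pointsMap G (sqZeroMap R (LinearMap.prod u 0)) z *
        pointsMap G (sqZeroMap R (LinearMap.prod 0 v)) z := by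
    have : ∀ b : Bool, IsLocalHom
        (sqZeroMap R (bif b then LinearMap.fst S N N else LinearMap.snd S N N)).toRingHom :=
      fun b => isLocalHom_trivSqZeroExt_map _
    refine points_ext G (S := fun _ => TrivSqZeroExt S N)
      (fun b : Bool => sqZeroMap R (bif b then LinearMap.fst S N N else LinearMap.snd S N N))
      (fun a b h => ?_) true fun b => ?_
    · have h1 := h true
      have h2 := h false
      simp only [sqZeroMap_apply, cond_true, cond_false] at h1 h2
      ext
      · simpa using congr(fst $h1)
      · simpa using congr(snd $h1)
      · simpa using congr(snd $h2)
    · cases b <;>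
        simp [pointsMap_sqZeroMap_comp, pointsMap_sqZeroMap_zero G hz, map_mul]
  have h := congrArg (pointsMap G (A' := TrivSqZeroExt S N)
    (sqZeroMap R (LinearMap.coprod (LinearMap.id : N →ₗ[S] N) LinearMap.id))) key
  simpa [pointsMap_sqZeroMap_comp, map_mul, LinearMap.coprod_comp_prod] using h

theorem pointsMap_sqZeroMap_nsmul [IsLocalRing S] (u : M →ₗ[S] N) (n : ℕ)
    {z : SchemePoints G (TrivSqZeroExt S M)} (hz : pointsMap G (fstHom R S M) z = 1) :
    pointsMap G (sqZeroMap R (n • u)) z = pointsMap G (sqZeroMap R u) z ^ n := by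
  induction n with
  | zero => simpa using pointsMap_sqZeroMap_zero G hz
  | succ n ih => rw [succ_nsmul, pointsMap_sqZeroMap_add G _ _ hz, ih, pow_succ]

theorem pow_eq_one_of_pointsMap_fst_eq_one [IsLocalRing S] {n : ℕ} (hn : ∀ m : M, n • m = 0)
    {z : SchemePoints G (TrivSqZeroExt S M)} (hz : pointsMap G (fstHom R S M) z = 1) :
    z ^ n = 1 := by
  have h := pointsMap_sqZeroMap_nsmul G (LinearMap.id : M →ₗ[S] M) n hz
  have h0 : n • (LinearMap.id : M →ₗ[S] M) = 0 := by ext m; simpa using hn m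
  have h1 : sqZeroMap R (LinearMap.id : M →ₗ[S] M) = AlgHom.id R _ := by
    ext <;> simp [sqZeroMap]
  rw [h0, pointsMap_sqZeroMap_zero G hz, h1, pointsMap_id] at h
  exact h.symm

variable (R) in
/-- The homomorphism `S ⊕ J → S`, `(a, j) ↦ a + j`, for an ideal `J` of square zero. -/
def sqZeroEval (J : Ideal S) (hJ : J ^ 2 = ⊥) : TrivSqZeroExt S J →ₐ[R] S :=
  (TrivSqZeroExt.lift (AlgHom.id S S) J.subtype
    (fun x y => by
      have : (x : S) * y ∈ J ^ 2 := by rw [sq]; exact Ideal.mul_mem_mul x.2 y.2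
      simpa [hJ] using this)
    (fun r x => by simp) (fun r x => by simp [mul_comm])).restrictScalars R

theorem sqZeroEval_apply (J : Ideal S) (hJ : J ^ 2 = ⊥) (a : TrivSqZeroExt S J) :
    sqZeroEval R J hJ a = a.fst + a.snd := rfl

/-- Two points over a local ring `S` that agree modulo an ideal `J` of square zero define a point
over `S ⊕ J`. -/
theorem exists_sqZero_point [IsLocalRing S] (J : Ideal S) (hJ : J ^ 2 = ⊥) {S' : Type u}
    [CommRing S'] [IsLocalRing S'] [Algebra R S'] (f : S →ₐ[R] S') [IsLocalHom f.toRingHom]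
    (hf : RingHom.ker f = J) {x y : SchemePoints G S} (hxy : pointsMap G f x = pointsMap G f y) :
    ∃ z : SchemePoints G (TrivSqZeroExt S J),
      pointsMap G (fstHom R S J) z = x ∧ pointsMap G (sqZeroEval R J hJ) z = y := by
  have hleft := congrArg (·.left) hxy
  simp only [pointsMap_left] at hleft
  obtain ⟨t, φ, ψ, hφ, hψ⟩ := exists_comp_fromSpecStalk_eq_pair f.toRingHom hleft
  have hmem : ∀ a, ψ a - φ a ∈ J := by
    rw [← hφ, ← hψ] at hleft
    intro a
    rw [← hf, RingHom.mem_ker, map_sub, sub_eq_zero]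
    exact congr($(comp_eq_of_specMap_comp_eq _ hleft) a).symm
  have hmul : ∀ j k : S, j ∈ J → k ∈ J → j * k = 0 := fun j k hj hk => by
    have : j * k ∈ J ^ 2 := by rw [sq]; exact Ideal.mul_mem_mul hj hk
    simpa [hJ] using this
  -- `φ + ε(ψ - φ)` is multiplicative because the product of two differences lies in `J ^ 2 = 0`.
  let θ : G.left.presheaf.stalk t →+* TrivSqZeroExt S J :=
    { toFun a := inl (φ a) + inr ⟨ψ a - φ a, hmem a⟩
      map_one' := by ext <;> simp
      map_zero' := by ext <;> simp
      map_add' a b := by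
        ext
        · simp
        · simp; ring
      map_mul' a b := by
        ext
        · simp
        · have := hmul _ _ (hmem a) (hmem b)
          simp
          linear_combination this }
  have h1 : Spec.map (CommRingCat.ofHom (fstHom R S J).toRingHom) ≫
      Spec.map (CommRingCat.ofHom θ) ≫ G.left.fromSpecStalk _ = x.left := by
    rw [← hφ, ← Category.assoc, ← Spec.map_comp, ← CommRingCat.ofHom_comp]
    congr 3
    ext a
    simp [θ]
  have h2 : Spec.map (CommRingCat.ofHom (sqZeroEval R J hJ).toRingHom) ≫
      Spec.map (CommRingCat.ofHom θ) ≫ G.left.fromSpecStalk _ = y.left := by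
    rw [← hψ, ← Category.assoc, ← Spec.map_comp, ← CommRingCat.ofHom_comp]
    congr 3
    ext a
    simp [θ, sqZeroEval_apply]
  have hw : (Spec.map (CommRingCat.ofHom θ) ≫ G.left.fromSpecStalk _) ≫ G.hom =
      Spec.map (CommRingCat.ofHom (algebraMap R (TrivSqZeroExt S J))) := by
    -- Compatibility with the structure map is tested on the jointly injective pair `(s, j) ↦ s` and
    -- `(s, j) ↦ s + j`.
    have : IsLocalHom ((fun b : Bool => bif b then fstHom R S J else sqZeroEval R J hJ)
      true).toRingHom := isLocalHom_fst
    refine spec_hom_ext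
      (fun b : Bool => (bif b then fstHom R S J else sqZeroEval R J hJ).toRingHom)
      (fun a b h => ?_) true ?_
    · have e1 : a.fst = b.fst := h true
      have e2 : sqZeroEval R J hJ a = sqZeroEval R J hJ b := h false
      rw [sqZeroEval_apply, sqZeroEval_apply, e1, add_right_inj] at e2
      ext
      · exact e1
      · exact e2
    · have e : ∀ g : TrivSqZeroExt S J →ₐ[R] S, Spec.map (CommRingCat.ofHom g.toRingHom) ≫
          Spec.map (CommRingCat.ofHom (algebraMap R (TrivSqZeroExt S J))) =
          Spec.map (CommRingCat.ofHom (algebraMap R S)) := fun g => by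
        rw [← Spec.map_comp, ← CommRingCat.ofHom_comp]
        congr 2
        exact g.comp_algebraMap
      rintro (_ | _)
      · exact (by rw [← Category.assoc, h2, e]; exact Over.w y)
      · exact (by rw [← Category.assoc, h1, e]; exact Over.w x)
  exact ⟨Over.homMk _ hw, by ext1; exact h1, by ext1; exact h2⟩

/-- The kernel of `G(S) → G(S / J)`, for an ideal `J` of square zero killed by `n`, is killed
by `n`. -/
theorem pow_eq_one_of_pointsMap_eq_one [IsLocalRing S] {S' : Type u}
    [CommRing S'] [IsLocalRing S'] [Algebra R S'] (f : S →ₐ[R] S') [IsLocalHom f.toRingHom]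
    (hf : RingHom.ker f ^ 2 = ⊥) {n : ℕ} (hn : ∀ a, f a = 0 → n • a = 0)
    {x : SchemePoints G S} (hx : pointsMap G f x = 1) : x ^ n = 1 := by
  obtain ⟨z, hz, rfl⟩ := exists_sqZero_point G (RingHom.ker f) hf f rfl
    (x := 1) (y := x) (by rw [hx, map_one])
  rw [← map_pow, pow_eq_one_of_pointsMap_fst_eq_one G _ hz, map_one]
  intro m
  ext
  exact hn m m.2

end SquareZero

end

noncomputable section

/-! ### The congruence filtration of `G(R)` and Hensel's lemma. -/

section Reduction

variable {R : Type u} [CommRing R] (G : Over (Spec (CommRingCat.of R))) [GrpObj G]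

theorem pointsMap_factor_reduction {I J : Ideal R} (h : I ≤ J) (a : SchemePoints G R) :
    pointsMap G (Ideal.Quotient.factorₐ R h) (reduction G I a) = reduction G J a :=
  pointsMap_pointsMap G _ (Ideal.Quotient.mkₐ R I) a

theorem reduction_eq_of_le {I J : Ideal R} (h : I ≤ J) {a b : SchemePoints G R}
    (hab : reduction G I a = reduction G I b) : reduction G J a = reduction G J b := by
  rw [← pointsMap_factor_reduction G h, hab, pointsMap_factor_reduction]

theorem ker_reduction_mono {I J : Ideal R} (h : I ≤ J) :
    (reduction G I).ker ≤ (reduction G J).ker := fun a ha => by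
  rw [MonoidHom.mem_ker, ← map_one (reduction G I)] at ha
  rw [MonoidHom.mem_ker, reduction_eq_of_le G h ha, map_one]

theorem tendsto_adicTopology_iff (𝔭 : Ideal R) {κ : Type*} (l : Filter κ)
    (u : κ → SchemePoints G R) (b : SchemePoints G R) :
    Filter.Tendsto u l (@nhds _ (adicTopology G 𝔭) b) ↔
      ∀ n, ∀ᶠ k in l, reduction G (𝔭 ^ n) (u k) = reduction G (𝔭 ^ n) b := by
  rw [nhds_iInf, Filter.tendsto_iInf]
  refine forall_congr' fun n => ?_
  let : TopologicalSpace (SchemePoints G (R ⧸ 𝔭 ^ n)) := ⊥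
  have : DiscreteTopology (SchemePoints G (R ⧸ 𝔭 ^ n)) := ⟨rfl⟩
  rw [nhds_induced, Filter.tendsto_comap_iff, nhds_discrete, Filter.tendsto_pure]
  rfl

variable [IsLocalRing R]

omit [IsLocalRing R] in
theorem isLocalHom_of_surjective_algHom {S S' : Type*} [CommRing S] [CommRing S'] [Algebra R S]
    [Algebra R S'] [IsLocalRing S] [Nontrivial S'] (f : S →ₐ[R] S') (hf : Function.Surjective f) :
    IsLocalHom f.toRingHom :=
  IsLocalHom.of_surjective f.toRingHom hf

theorem isLocalRing_quotient {I : Ideal R} (hI : I ≠ ⊤) : IsLocalRing (R ⧸ I) :=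
  have := Ideal.Quotient.nontrivial_iff.2 hI
  IsLocalRing.of_surjective' (Ideal.Quotient.mk I) Ideal.Quotient.mk_surjective

variable (𝔭 : Ideal R)

theorem reduction_injective [IsHausdorff 𝔭 R] (h𝔭 : 𝔭 ≠ ⊤) {x y : SchemePoints G R}
    (h : ∀ n, reduction G (𝔭 ^ n) x = reduction G (𝔭 ^ n) y) : x = y := by
  have h1 : 𝔭 ^ 1 ≠ ⊤ := by rwa [pow_one]
  have := isLocalRing_quotient h1
  have := isLocalHom_of_surjective_algHom (Ideal.Quotient.mkₐ R (𝔭 ^ 1))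
    Ideal.Quotient.mk_surjective
  -- The local member of the family is `n = 1`, as `R ⧸ 𝔭 ^ 0` is the zero ring.
  refine points_ext G (fun n => Ideal.Quotient.mkₐ R (𝔭 ^ n)) (fun a b hab => ?_) 1 h
  rw [IsHausdorff.eq_iff_smodEq (I := 𝔭)]
  intro n
  rw [smul_eq_mul, Ideal.mul_top]
  exact (SModEq.def).2 (hab n)

/-- All `u n` agree modulo `𝔭`, so they factor through one stalk; completeness of `R` glues the
resulting homomorphisms to `R ⧸ 𝔭 ^ n` into one homomorphism to `R`. -/
theorem exists_limit_of_reduction_eq [IsAdicComplete 𝔭 R] (h𝔭 : 𝔭 ≠ ⊤)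
    (u : ℕ → SchemePoints G R)
    (hu : ∀ n, reduction G (𝔭 ^ (n + 1)) (u (n + 1)) = reduction G (𝔭 ^ (n + 1)) (u n)) :
    ∃ L, ∀ n, reduction G (𝔭 ^ n) L = reduction G (𝔭 ^ n) (u n) := by
  have h1 : 𝔭 ^ 1 ≠ ⊤ := by rwa [pow_one]
  have := isLocalRing_quotient h1
  have hloc := isLocalHom_of_surjective_algHom (Ideal.Quotient.mkₐ R (𝔭 ^ 1))
    Ideal.Quotient.mk_surjective
  have hmn : ∀ m n, m ≤ n → reduction G (𝔭 ^ m) (u n) = reduction G (𝔭 ^ m) (u m) := by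
    intro m n h
    induction n, h using Nat.le_induction with
    | base => rfl
    | succ n h ih =>
      exact (reduction_eq_of_le G (Ideal.pow_le_pow_right (by omega)) (hu n)).trans ih
  have hpt : ∀ n, (u n).left (closedPoint R) = (u 0).left (closedPoint R) := by
    intro n
    have e : reduction G (𝔭 ^ 1) (u n) = reduction G (𝔭 ^ 1) (u 0) := by
      induction n with
      | zero => rfl
      | succ n ih =>
        exact (reduction_eq_of_le G (Ideal.pow_le_pow_right (by omega)) (hu n)).trans ih
    have e' := congrArg (·.left) e
    rw [← specMap_comp_apply_closedPoint (Ideal.Quotient.mkₐ R (𝔭 ^ 1)).toRingHom (u n).left,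
      ← specMap_comp_apply_closedPoint (Ideal.Quotient.mkₐ R (𝔭 ^ 1)).toRingHom (u 0).left]
    exact congrArg (fun z : Spec (CommRingCat.of (R ⧸ 𝔭 ^ 1)) ⟶ G.left => z (closedPoint _)) e'
  choose φ hφ using fun n => exists_comp_fromSpecStalk_eq (u n).left _ (hpt n)
  have hcomp : ∀ m n, m ≤ n →
      (Ideal.Quotient.mk (𝔭 ^ m)).comp (φ n) = (Ideal.Quotient.mk (𝔭 ^ m)).comp (φ m) :=
    fun m n h => comp_eq_of_specMap_comp_eq _ (by
      rw [hφ, hφ]; exact congrArg (·.left) (hmn m n h))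
  let ψ := IsAdicComplete.liftRingHom 𝔭 (fun n => (Ideal.Quotient.mk (𝔭 ^ n)).comp (φ n))
    (fun {m n} h => by rw [← hcomp m n h]; rfl)
  have hψ : ∀ n, (Ideal.Quotient.mk (𝔭 ^ n)).comp ψ = (Ideal.Quotient.mk (𝔭 ^ n)).comp (φ n) :=
    fun n => IsAdicComplete.mk_comp_liftRingHom ..
  have hL : ∀ n, Spec.map (CommRingCat.ofHom (Ideal.Quotient.mk (𝔭 ^ n))) ≫
      Spec.map (CommRingCat.ofHom ψ) ≫ G.left.fromSpecStalk _ =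
      Spec.map (CommRingCat.ofHom (Ideal.Quotient.mk (𝔭 ^ n))) ≫ (u n).left := fun n => by
    rw [← hφ n, ← Category.assoc, ← Category.assoc, ← Spec.map_comp, ← Spec.map_comp,
      ← CommRingCat.ofHom_comp, ← CommRingCat.ofHom_comp, hψ]
  have hw : (Spec.map (CommRingCat.ofHom ψ) ≫ G.left.fromSpecStalk _) ≫ G.hom =
      Spec.map (CommRingCat.ofHom (algebraMap R R)) := by
    have : IsLocalHom (Ideal.Quotient.mk (𝔭 ^ 1)) := hloc
    refine spec_hom_ext (fun n => Ideal.Quotient.mk (𝔭 ^ n)) (fun a b hab => ?_) 1 fun n => ?_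
    · rw [IsHausdorff.eq_iff_smodEq (I := 𝔭)]
      intro n
      rw [smul_eq_mul, Ideal.mul_top]
      exact (SModEq.def).2 (hab n)
    · rw [← Category.assoc, hL, Category.assoc]
      exact congrArg _ (Over.w (u n))
  exact ⟨Over.homMk _ hw, fun n => by ext1; exact hL n⟩

/-- The ideal `𝔭^(n+1)/𝔭^(n+2)` has square zero as `2n + 2 ≥ n + 2`, and `p ∈ 𝔭` kills it. -/
theorem pow_mem_ker_reduction_succ (h𝔭 : 𝔭 ≠ ⊤) {p : ℕ} (hp : (p : R) ∈ 𝔭) (n : ℕ)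
    {x : SchemePoints G R} (hx : x ∈ (reduction G (𝔭 ^ (n + 1))).ker) :
    x ^ p ∈ (reduction G (𝔭 ^ (n + 2))).ker := by
  have hne : ∀ k, 𝔭 ^ (k + 1) ≠ ⊤ := fun k h =>
    h𝔭 (top_le_iff.1 (h ▸ Ideal.pow_le_self k.succ_ne_zero))
  have := isLocalRing_quotient (hne (n + 1))
  have := isLocalRing_quotient (hne n)
  have hle : 𝔭 ^ (n + 2) ≤ 𝔭 ^ (n + 1) := Ideal.pow_le_pow_right (by omega)
  have := isLocalHom_of_surjective_algHom (Ideal.Quotient.factorₐ R hle)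
    (Ideal.Quotient.factor_surjective hle)
  have hmem : ∀ r : R, Ideal.Quotient.factorₐ R hle (Ideal.Quotient.mk _ r) = 0 →
      r ∈ 𝔭 ^ (n + 1) := fun r hr => Ideal.Quotient.eq_zero_iff_mem.1 hr
  rw [MonoidHom.mem_ker, map_pow]
  refine pow_eq_one_of_pointsMap_eq_one G (Ideal.Quotient.factorₐ R hle) ?_ ?_ ?_
  · rw [eq_bot_iff, sq, Ideal.mul_le]
    intro a ha b hb
    obtain ⟨a, rfl⟩ := Ideal.Quotient.mk_surjective a
    obtain ⟨b, rfl⟩ := Ideal.Quotient.mk_surjective b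
    rw [Ideal.mem_bot, ← map_mul, Ideal.Quotient.eq_zero_iff_mem]
    have := Ideal.mul_mem_mul (hmem a ha) (hmem b hb)
    rw [← pow_add] at this
    exact Ideal.pow_le_pow_right (by omega) this
  · intro a ha
    obtain ⟨a, rfl⟩ := Ideal.Quotient.mk_surjective a
    rw [← map_nsmul, Ideal.Quotient.eq_zero_iff_mem, nsmul_eq_mul, pow_succ']
    exact Ideal.mul_mem_mul hp (hmem a ha)
  · rw [pointsMap_factor_reduction]
    exact hx

omit [IsLocalRing R] in
theorem ker_reduction_pow_one : (reduction G (𝔭 ^ 1)).ker = (reduction G 𝔭).ker := by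
  rw [pow_one]

theorem isProPFiltration_ker_reduction [IsCommMonObj G] [IsAdicComplete 𝔭 R] (h𝔭 : 𝔭 ≠ ⊤)
    {p : ℕ} (hp : (p : R) ∈ 𝔭) :
    IsProPFiltration p (reduction G 𝔭).ker fun n => (reduction G (𝔭 ^ n)).ker where
  antitone _ _ h := ker_reduction_mono G (Ideal.pow_le_pow_right h)
  le n := ker_reduction_mono G (Ideal.pow_le_self n.succ_ne_zero)
  separated x hx := reduction_injective G 𝔭 h𝔭 fun n => by rw [map_one]; exact hx n
  complete u hu := by
    simp only [MonoidHom.mem_ker, map_div, div_eq_one] at hu ⊢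
    -- Shifting the sequence by one supplies the congruence modulo `𝔭 ^ (n + 1)` that the limit
    -- lemma requires.
    obtain ⟨L, hL⟩ := exists_limit_of_reduction_eq G 𝔭 h𝔭 (fun n => u (n + 1))
      fun n => hu (n + 1)
    exact ⟨L, fun n => (hL n).trans (hu n)⟩
  pow_pow_mem n x hx := by
    -- The induction starts at level 1, where `x` is already trivial, so it yields one level more
    -- than needed.
    have key : ∀ n, x ^ p ^ n ∈ (reduction G (𝔭 ^ (n + 1))).ker := fun n => by
      induction n with
      | zero => simpa [ker_reduction_pow_one] using hx
      | succ n ih =>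
        rw [pow_succ p, pow_mul]
        exact pow_mem_ker_reduction_succ G 𝔭 h𝔭 hp n ih
    exact ker_reduction_mono G (Ideal.pow_le_pow_right n.le_succ) (key n)

/-- Hensel's lemma for smooth schemes over a complete local ring. -/
theorem reduction_surjective [𝔭.IsMaximal] [IsAdicComplete 𝔭 R] (hG : Smooth G.hom) :
    Function.Surjective (reduction G 𝔭) := by
  intro x
  have := isLocalRing_quotient (Ideal.IsPrime.ne_top' (I := 𝔭))
  obtain ⟨φ, hφ⟩ := exists_comp_fromSpecStalk_eq x.left _ rfl
  generalize x.left (closedPoint (R ⧸ 𝔭)) = t at φ hφ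
  -- An affine neighbourhood of the image of the closed point contains the whole point, so lifting
  -- becomes a question about the smooth `R`-algebra `Γ(G, U)`.
  obtain ⟨_, ⟨U, (hU : IsAffineOpen U), rfl⟩, ht, -⟩ := G.left.isBasis_affineOpens.exists_subset_of_mem_open
    (Set.mem_univ t) isOpen_univ
  have hstalk : Spec.map (G.left.presheaf.germ U t ht) ≫ hU.fromSpec = G.left.fromSpecStalk t :=
    IsAffineOpen.fromSpecStalk_eq_fromSpecStalk hU ht
  obtain ⟨α, hα⟩ : ∃ α : Γ(G.left, U) ⟶ CommRingCat.of (R ⧸ 𝔭),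
      Spec.map α ≫ hU.fromSpec = x.left :=
    ⟨_, by rwa [← hstalk, ← Category.assoc, ← Spec.map_comp] at hφ⟩
  obtain ⟨g, hg⟩ : ∃ g : CommRingCat.of R ⟶ Γ(G.left, U), Spec.map g = hU.fromSpec ≫ G.hom :=
    ⟨Spec.preimage _, Spec.map_preimage _⟩
  have hgs : g.hom.Smooth := by
    rw [← HasRingHomProperty.Spec_iff (P := @Smooth), hg]
    exact MorphismProperty.comp_mem _ _ _ inferInstance hG
  have hαg : g ≫ α = CommRingCat.ofHom (algebraMap R (R ⧸ 𝔭)) := by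
    apply Spec.map_injective
    rw [Spec.map_comp, hg, ← Category.assoc, hα]
    exact Over.w x
  let := g.hom.toAlgebra
  have : Algebra.Smooth R Γ(G.left, U) := hgs
  obtain ⟨β, hβ⟩ := Algebra.FormallySmooth.exists_mkₐ_comp_eq_of_isAdicComplete (R := R) (I := 𝔭)
    ({ α.hom with commutes' := fun r => congr($(hαg).hom r) } : Γ(G.left, U) →ₐ[R] R ⧸ 𝔭)
  refine ⟨Over.homMk (Spec.map (CommRingCat.ofHom β.toRingHom) ≫ hU.fromSpec) ?_, ?_⟩
  · change (_ ≫ _) ≫ _ = Spec.map (CommRingCat.ofHom (algebraMap R R))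
    rw [Category.assoc, ← hg, ← Spec.map_comp]
    congr 1
    ext r
    exact β.commutes r
  · ext1
    change Spec.map (CommRingCat.ofHom (Ideal.Quotient.mkₐ R 𝔭).toRingHom) ≫
      Spec.map (CommRingCat.ofHom β.toRingHom) ≫ hU.fromSpec = x.left
    rw [← hα, ← Category.assoc, ← Spec.map_comp]
    congr 2
    ext r
    exact congr($hβ r)

end Reduction

end

end

/-! ### The theorem over complete local rings and over the integers of `K`. -/

/-- Teichmüller representatives for a commutative group scheme over a complete local ring of
residue characteristic `p`. -/
theorem teichmuller_of_isAdicComplete (p : ℕ) [Fact p.Prime] (R : Type u) [CommRing R]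
    [IsLocalRing R] (𝔭 : Ideal R) [𝔭.IsMaximal] [IsAdicComplete 𝔭 R] (hp : (p : R) ∈ 𝔭)
    (G : Over (Spec (CommRingCat.of R))) [GrpObj G] [IsCommMonObj G] :
    (∃ χ : pointsPrimeToP G p 𝔭 →* primeToPart p (SchemePoints G R),
      -- (a) congruence and uniqueness
      (∀ a, reduction G 𝔭 (χ a) = reduction G 𝔭 a) ∧
      (∀ ψ : pointsPrimeToP G p 𝔭 →* primeToPart p (SchemePoints G R),
        (∀ a, reduction G 𝔭 (ψ a) = reduction G 𝔭 a) → ψ = χ) ∧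
      -- (b) the limit of `a ^ (p ^ k)` over `p ^ k ≡ 1` mod `τ(a)` exists and is `χ a`
      (∀ a : pointsPrimeToP G p 𝔭, ∀ b : SchemePoints G R,
        Filter.Tendsto (fun k : ℕ => (a : SchemePoints G R) ^ p ^ k)
          (Filter.atTop ⊓
            Filter.principal {k : ℕ | p ^ k ≡ 1 [MOD orderOf (reduction G 𝔭 a)]})
          (@nhds _ (adicTopology G 𝔭) b) ↔ b = χ a) ∧
      -- (c) the order of `χ a`
      (∀ a, orderOf (χ a) = orderOf (reduction G 𝔭 a)) ∧
      -- (a), continued: uniqueness among all homomorphisms to the torsion of `G(R)`,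
      -- if no point of order `p` reduces to the identity
      ((∀ x : SchemePoints G R,
          reduction G 𝔭 x = 1 → x ^ p = 1 → x = 1) →
        ∀ ψ : pointsPrimeToP G p 𝔭 →*
            CommGroup.torsion (SchemePoints G R),
          (∀ a, reduction G 𝔭 (ψ a) = reduction G 𝔭 a) →
            ∀ a, (ψ a : SchemePoints G R) = χ a)) ∧
    -- (d) reduction on prime-to-`p` torsion
    Function.Injective (primeToPartMap p (reduction G 𝔭)) ∧
    (Smooth G.hom → Function.Bijective (primeToPartMap p (reduction G 𝔭))) ∧
    -- (d), continued: under the same condition, this is the whole torsion of `G'(R)`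
    ((∀ x : SchemePoints G R,
        reduction G 𝔭 x = 1 → x ^ p = 1 → x = 1) →
      ∀ a ∈ pointsPrimeToP G p 𝔭, IsOfFinOrder a →
        a ∈ primeToPart p (SchemePoints G R)) := by
  have h𝔭 : 𝔭 ≠ ⊤ := Ideal.IsPrime.ne_top'
  have hN := isProPFiltration_ker_reduction G 𝔭 h𝔭 hp
  obtain ⟨χ, hχ, hlim⟩ := hN.exists_character (H := pointsPrimeToP G p 𝔭) fun a ha => ha
  refine ⟨⟨χ, hχ, ?_, ?_, ?_, ?_⟩, ?_, ?_, ?_⟩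
  · intro ψ hψ
    refine MonoidHom.ext fun a => Subtype.ext ?_
    exact hN.eq_of_map_eq (ψ a).2 (χ a).2 ((hψ a).trans (hχ a).symm)
  · intro a b
    have hpt : p.Coprime (orderOf (reduction G 𝔭 a)) :=
      ((Fact.out : p.Prime).coprime_iff_not_dvd).2 a.2
    have hne := neBot_atTop_inf_principal_pow_modEq_one hpt (orderOf_pos_of_not_dvd a.2)
    have hev : ∀ n, ∀ᶠ k in Filter.atTop ⊓
        Filter.principal {k : ℕ | p ^ k ≡ 1 [MOD orderOf (reduction G 𝔭 a)]},
        reduction G (𝔭 ^ n) ((a : SchemePoints G R) ^ p ^ k) =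
          reduction G (𝔭 ^ n) (χ a) := fun n => by
      rw [Filter.eventually_inf_principal]
      filter_upwards [Filter.eventually_ge_atTop n] with k hk hmod
      have h := hlim a n k hk hmod
      rw [MonoidHom.mem_ker, map_div, div_eq_one] at h
      exact h.symm
    rw [tendsto_adicTopology_iff]
    constructor
    · intro h
      refine reduction_injective G 𝔭 h𝔭 fun n => ?_
      -- As the filter is nontrivial, some `a ^ p ^ k` is congruent to both `b` and `χ a` modulo `𝔭
      -- ^ n`.
      obtain ⟨k, h1, h2⟩ := ((h n).and (hev n)).exists
      exact h1.symm.trans h2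
    · rintro rfl
      exact hev
  · intro a
    rw [← Subgroup.orderOf_coe, hN.orderOf_map (χ a).2, hχ]
  · intro h ψ hψ a
    refine hN.eq_of_map_eq (mem_primeToPart_of_isOfFinOrder h ?_ (ψ a).2) (χ a).2
      ((hψ a).trans (hχ a).symm)
    rw [hψ]
    exact a.2
  · exact hN.injective
  · exact fun hG => ⟨hN.injective, hN.surjective (reduction_surjective G 𝔭 hG)⟩
  · exact fun h a ha hfin => mem_primeToPart_of_isOfFinOrder h ha hfin

theorem proposition10 (p : ℕ) [Fact p.Prime] (K : Type u) [Field K] [Algebra ℚ_[p] K]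
    [FiniteDimensional ℚ_[p] K] [Algebra ℤ_[p] K] [IsScalarTower ℤ_[p] ℚ_[p] K]
    (𝔭 : Ideal (integralClosure ℤ_[p] K)) [𝔭.IsMaximal]
    (G : Over (Spec (CommRingCat.of (integralClosure ℤ_[p] K)))) [GrpObj G] [IsCommMonObj G] :
    (∃ χ : pointsPrimeToP G p 𝔭 →* primeToPart p (SchemePoints G (integralClosure ℤ_[p] K)),
      -- (a) congruence and uniqueness
      (∀ a, reduction G 𝔭 (χ a) = reduction G 𝔭 a) ∧
      (∀ ψ : pointsPrimeToP G p 𝔭 →* primeToPart p (SchemePoints G (integralClosure ℤ_[p] K)),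
        (∀ a, reduction G 𝔭 (ψ a) = reduction G 𝔭 a) → ψ = χ) ∧
      -- (b) the limit of `a ^ (p ^ k)` over `p ^ k ≡ 1` mod `τ(a)` exists and is `χ a`
      (∀ a : pointsPrimeToP G p 𝔭, ∀ b : SchemePoints G (integralClosure ℤ_[p] K),
        Filter.Tendsto (fun k : ℕ => (a : SchemePoints G (integralClosure ℤ_[p] K)) ^ p ^ k)
          (Filter.atTop ⊓
            Filter.principal {k : ℕ | p ^ k ≡ 1 [MOD orderOf (reduction G 𝔭 a)]})
          (@nhds _ (adicTopology G 𝔭) b) ↔ b = χ a) ∧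
      -- (c) the order of `χ a`
      (∀ a, orderOf (χ a) = orderOf (reduction G 𝔭 a)) ∧
      -- (a), continued: uniqueness among all homomorphisms to the torsion of `G(R)`,
      -- if no point of order `p` reduces to the identity
      ((∀ x : SchemePoints G (integralClosure ℤ_[p] K),
          reduction G 𝔭 x = 1 → x ^ p = 1 → x = 1) →
        ∀ ψ : pointsPrimeToP G p 𝔭 →*
            CommGroup.torsion (SchemePoints G (integralClosure ℤ_[p] K)),
          (∀ a, reduction G 𝔭 (ψ a) = reduction G 𝔭 a) →
            ∀ a, (ψ a : SchemePoints G (integralClosure ℤ_[p] K)) = χ a)) ∧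
    -- (d) reduction on prime-to-`p` torsion
    Function.Injective (primeToPartMap p (reduction G 𝔭)) ∧
    (Smooth G.hom → Function.Bijective (primeToPartMap p (reduction G 𝔭))) ∧
    -- (d), continued: under the same condition, this is the whole torsion of `G'(R)`
    ((∀ x : SchemePoints G (integralClosure ℤ_[p] K),
        reduction G 𝔭 x = 1 → x ^ p = 1 → x = 1) →
      ∀ a ∈ pointsPrimeToP G p 𝔭, IsOfFinOrder a →
        a ∈ primeToPart p (SchemePoints G (integralClosure ℤ_[p] K))) := by
  have := isLocalRing_integralClosure_padicInt p K
  have := isAdicComplete_integralClosure_padicInt p K 𝔭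
  exact teichmuller_of_isAdicComplete p (integralClosure ℤ_[p] K) 𝔭
    (natCast_mem_maximal_integralClosure_padicInt p K 𝔭) G
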